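/- Let $\triangle_0$ be a (nondegenerate) hyperbolic triangle with ordered vertices $A_0,B_0,C_0$ in the hyperbolic plane. For a triangle $\triangle=\triangle_{ABC}$ let $M_{XY}$ be the hyperbolic midpoint of the edge $XY$, and put $$f_A(\triangle)=(A,M_{AB},M_{AC}),\quad f_B(\triangle)=(M_{AB},B,M_{BC}),\quad f_C(\triangle)=(M_{AC},M_{BC},C),\quad f_M(\triangle)=(M_{BC},M_{CA},M_{AB}),$$ as ordered triangles. Let $(s_n)_{n\ge 0}$ be any sequence in $\{A,B,C,M\}$ and define $\triangle_{n+1}=f_{s_n}(\triangle_n)$. Let $(A_n,B_n,C_n)$ also denote the ordered triple of angles of $\triangle_n$, and let $a_0,b_0,c_0$ be the lengths of the edges of $\triangle_0$ opposite to its first, second and third vertex. Then: 1. Every $\triangle_n$ is a nondegenerate hyperbolic triangle, so $A_n,B_n,C_n>0$ and $A_n+B_n+C_n<\pi$. 2. The sequence $\triangle_n$ converges in angle space to a nondegenerate Euclidean triangle: there are $\alpha,\beta,\gamma>0$ with $\alpha+\beta+\gamma=\pi$ such that $(A_n,B_n,C_n)\to(\alpha,\beta,\gamma)$ in $\mathbb{R}^3$.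 3. The sequence $\ln\sin A_n$ is Cauchy, and for all $n,k\ge 0$ $$\bigl|\ln\sin A_{n+k}-\ln\sin A_n\bigr|<\frac1{2^n}\left(\sinh^2\frac{a_0}2+\sinh^2\frac{b_0}2+\sinh^2\frac{c_0}2\right);$$ the same holds with $B_n$, and with $C_n$, in place of $A_n$ (with the same right-hand side). -/

import Mathlib

open Filter Topology

noncomputable section

namespace HypIFS

/-- The hyperbolic midpoint of two points of the hyperbolic plane (upper half-plane model):
the midpoint of the geodesic segment joining `z` and `w`; see `dist_midpt_left` and
`dist_midpt_right`. -/
def midpt (z w : UpperHalfPlane) : UpperHalfPlane :=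
  ⟨⟨(z.re * w.im + w.re * z.im) / (z.im + w.im),
    Real.sqrt (z.im * w.im) * Real.sqrt ((z.re - w.re) ^ 2 + (z.im + w.im) ^ 2) /
      (z.im + w.im)⟩, by
    have hz := z.im_pos
    have hw := w.im_pos
    show 0 < Real.sqrt (z.im * w.im) * Real.sqrt ((z.re - w.re) ^ 2 + (z.im + w.im) ^ 2) /
      (z.im + w.im)
    positivity⟩

theorem midpt_comm (z w : UpperHalfPlane) : midpt z w = midpt w z := by
  apply UpperHalfPlane.ext
  apply Complex.ext
  · show (z.re * w.im + w.re * z.im) / (z.im + w.im) = (w.re * z.im + z.re * w.im) / (w.im + z.im)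
    ring
  · show Real.sqrt (z.im * w.im) * Real.sqrt ((z.re - w.re) ^ 2 + (z.im + w.im) ^ 2) /
      (z.im + w.im) = Real.sqrt (w.im * z.im) *
      Real.sqrt ((w.re - z.re) ^ 2 + (w.im + z.im) ^ 2) / (w.im + z.im)
    ring_nf

theorem dist_midpt_left (z w : UpperHalfPlane) : dist z (midpt z w) = dist z w / 2 := by
  have hz := z.im_pos
  have hw := w.im_pos
  have hr : 0 < Real.sqrt (z.im * w.im) := by positivity
  have hE : 0 < Real.sqrt ((z.re - w.re) ^ 2 + (z.im + w.im) ^ 2) := by positivity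
  have hr2 : Real.sqrt (z.im * w.im) ^ 2 = z.im * w.im := Real.sq_sqrt (by positivity)
  have hE2 : Real.sqrt ((z.re - w.re) ^ 2 + (z.im + w.im) ^ 2) ^ 2 =
    (z.re - w.re) ^ 2 + (z.im + w.im) ^ 2 := Real.sq_sqrt (by positivity)
  have hre : (midpt z w).re = (z.re * w.im + w.re * z.im) / (z.im + w.im) := rfl
  have him : (midpt z w).im = Real.sqrt (z.im * w.im) *
    Real.sqrt ((z.re - w.re) ^ 2 + (z.im + w.im) ^ 2) / (z.im + w.im) := rfl
  have h1 : Real.cosh (dist z (midpt z w)) =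
      Real.sqrt ((z.re - w.re) ^ 2 + (z.im + w.im) ^ 2) / (2 * Real.sqrt (z.im * w.im)) := by
    rw [UpperHalfPlane.cosh_dist', hre, him]
    set r := Real.sqrt (z.im * w.im)
    set E := Real.sqrt ((z.re - w.re) ^ 2 + (z.im + w.im) ^ 2)
    field_simp
    linear_combination (E ^ 2) * hr2 - z.im ^ 2 * hE2
  have h2 : Real.cosh (2 * dist z (midpt z w)) = Real.cosh (dist z w) := by
    rw [Real.cosh_two_mul, Real.sinh_sq, h1, UpperHalfPlane.cosh_dist', div_pow, mul_pow, hE2, hr2]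
    field_simp
    ring
  have h3 := (Real.cosh_strictMonoOn.injOn) (x₁ := 2 * dist z (midpt z w)) (x₂ := dist z w)
    (by simp) (by simp) h2
  linarith

theorem dist_midpt_right (z w : UpperHalfPlane) : dist (midpt z w) w = dist z w / 2 := by
  rw [dist_comm, midpt_comm, dist_midpt_left, dist_comm]

/-- The angle at the vertex `P` between the geodesic rays from `P` through `Q` and through `R`.
The isometry `z ↦ (z - P) / (z - conj P)` from the upper half-plane to the (conformal) Poincaré
disk carries `P` to the centre `0` and the two rays to Euclidean rays from `0`, so
the hyperbolic angle is the Euclidean angle between the images of `Q` and `R`. -/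
def angle (P Q R : UpperHalfPlane) : ℝ :=
  InnerProductGeometry.angle
    (((Q : ℂ) - P) / ((Q : ℂ) - (starRingEnd ℂ) (P : ℂ)))
    (((R : ℂ) - P) / ((R : ℂ) - (starRingEnd ℂ) (P : ℂ)))

/-- The geodesic segment joining `P` and `Q`. -/
def segment (P Q : UpperHalfPlane) : Set UpperHalfPlane :=
  {X | dist P X + dist X Q = dist P Q}

/-- An ordered triple of points of the hyperbolic plane. -/
structure Triangle where
  A : UpperHalfPlane
  B : UpperHalfPlane
  C : UpperHalfPlane

namespace Triangle

/-- The three points are the vertices of a genuine triangle, i.e. they do not lie on a common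
geodesic: none of them lies on the geodesic segment joining the other two. -/
def Nondegenerate (T : Triangle) : Prop :=
  T.A ∉ segment T.B T.C ∧ T.B ∉ segment T.C T.A ∧ T.C ∉ segment T.A T.B

/-- Length of the edge `BC`. -/
def a (T : Triangle) : ℝ := dist T.B T.C

/-- Length of the edge `CA`. -/
def b (T : Triangle) : ℝ := dist T.C T.A

/-- Length of the edge `AB`. -/
def c (T : Triangle) : ℝ := dist T.A T.B

def angleA (T : Triangle) : ℝ := angle T.A T.B T.C

def angleB (T : Triangle) : ℝ := angle T.B T.C T.A

def angleC (T : Triangle) : ℝ := angle T.C T.A T.B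

/-- The ordered triple of angles, which parametrizes the triangle up to congruence. -/
def angles (T : Triangle) : ℝ × ℝ × ℝ := (T.angleA, T.angleB, T.angleC)

/-- The corner triangle at `A`. -/
def fA (T : Triangle) : Triangle := ⟨T.A, midpt T.A T.B, midpt T.A T.C⟩

/-- The corner triangle at `B`. -/
def fB (T : Triangle) : Triangle := ⟨midpt T.A T.B, T.B, midpt T.B T.C⟩

/-- The corner triangle at `C`. -/
def fC (T : Triangle) : Triangle := ⟨midpt T.A T.C, midpt T.B T.C, T.C⟩

/-- The medial triangle: each vertex is the midpoint of the opposite edge. -/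
def fM (T : Triangle) : Triangle := ⟨midpt T.B T.C, midpt T.C T.A, midpt T.A T.B⟩

end Triangle

/-- The four letters indexing the functions of the iterated function system. -/
inductive Letter where
  | A
  | B
  | C
  | M

/-- The function of the iterated function system indexed by a letter. -/
def step : Letter → Triangle → Triangle
  | Letter.A => Triangle.fA
  | Letter.B => Triangle.fB
  | Letter.C => Triangle.fC
  | Letter.M => Triangle.fM

/-- The sequence of triangles obtained from `T₀` by successively applying the functions
indexed by `s 0, s 1, s 2, …`. -/
def iter (s : ℕ → Letter) (T₀ : Triangle) : ℕ → Triangle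
  | 0 => T₀
  | n + 1 => step (s n) (iter s T₀ n)

/-- The space of hyperbolic triangles in angle coordinates. -/
def hyperbolicAngles : Set (ℝ × ℝ × ℝ) :=
  {p | 0 < p.1 ∧ 0 < p.2.1 ∧ 0 < p.2.2 ∧ p.1 + p.2.1 + p.2.2 < Real.pi}

/-- The space of nondegenerate Euclidean triangles modulo similarity, in angle coordinates. -/
def euclideanAngles : Set (ℝ × ℝ × ℝ) :=
  {p | 0 < p.1 ∧ 0 < p.2.1 ∧ 0 < p.2.2 ∧ p.1 + p.2.1 + p.2.2 = Real.pi}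

/-- `sinh² (a/2) + sinh² (b/2) + sinh² (c/2)`. -/
def sizeConst (T : Triangle) : ℝ :=
  Real.sinh (T.a / 2) ^ 2 + Real.sinh (T.b / 2) ^ 2 + Real.sinh (T.c / 2) ^ 2

/-- The sequence `ln sin θ (△ₙ)` is Cauchy, and its increments beyond the index `n` are smaller
than `2⁻ⁿ K`. -/
def LogSinCauchy (θ : Triangle → ℝ) (T : ℕ → Triangle) (K : ℝ) : Prop :=
  CauchySeq (fun n => Real.log (Real.sin (θ (T n)))) ∧
    ∀ n k : ℕ, |Real.log (Real.sin (θ (T (n + k)))) - Real.log (Real.sin (θ (T n)))|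
      < (1 / 2 ^ n) * K

end HypIFS

end

namespace HypIFS

open Real

/-! With G the symmetric Gram determinant `gram a b c`, the sine of the angle A is √G / (sinh b sinh
c). Each of the four maps divides G by the square of 4 times a product of cosh of half edges, and
turns edges into half edges or midsegments, so every change of ln sin is an explicit sum of terms ln
cosh(edge/2) and ln(sinh(a/2) / sinh m), with m the midsegment facing a. Since m ≤ a/2 and
sinh²(a/2) ≤ cosh(b/2) cosh(c/2) sinh² m, the change is at most S/2, where S is the sum of
sinh²(edge/2); and S shrinks by a factor of at least 4 at each step. Telescoping gives the Cauchy
estimate, and positivity of G hands nondegeneracy on to the next triangle.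

The sines therefore have positive limits. A sine alone does not determine its angle, but cos A +
cos(B + C) = sin B sin C (cosh a - 1) tends to 0, and this together with the three sines determines
cos A in the limit. The same relation forces the limiting angles to sum to π. -/

/-! ### Distances to and between midpoints. -/

theorem cosh_half_dist (z w : UpperHalfPlane) :
    cosh (dist z w / 2) =
      √((z.re - w.re) ^ 2 + (z.im + w.im) ^ 2) / (2 * √(z.im * w.im)) := by
  have hz := z.im_pos
  have hw := w.im_pos
  have hr : 0 < √(z.im * w.im) := by positivity
  have h : cosh (dist z w / 2) ^ 2 =
      (√((z.re - w.re) ^ 2 + (z.im + w.im) ^ 2) / (2 * √(z.im * w.im))) ^ 2 := by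
    have h1 : cosh (dist z w) = 2 * cosh (dist z w / 2) ^ 2 - 1 := by
      rw [← mul_div_cancel₀ (dist z w) (two_ne_zero), cosh_two_mul, sinh_sq]
      ring_nf
    rw [UpperHalfPlane.cosh_dist'] at h1
    rw [div_pow, mul_pow, sq_sqrt (by positivity), sq_sqrt (by positivity)]
    have h2 : cosh (dist z w / 2) ^ 2 =
      (((z.re - w.re) ^ 2 + z.im ^ 2 + w.im ^ 2) / (2 * z.im * w.im) + 1) / 2 := by linarith
    rw [h2]
    field_simp
    ring
  exact (pow_left_inj₀ (cosh_pos _).le (by positivity) two_ne_zero).1 h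

/-- In the hyperboloid model the midpoint is (z + w) / (2 cosh(d/2)), and cosh of the distance is,
up to sign, the Lorentz form, which is linear in each argument. -/
theorem cosh_dist_midpt (z w v : UpperHalfPlane) :
    cosh (dist (midpt z w) v) =
      (cosh (dist z v) + cosh (dist w v)) / (2 * cosh (dist z w / 2)) := by
  have hz := z.im_pos
  have hw := w.im_pos
  have hv := v.im_pos
  have hr : 0 < √(z.im * w.im) := by positivity
  have hE : 0 < √((z.re - w.re) ^ 2 + (z.im + w.im) ^ 2) := by positivity
  have hr2 : √(z.im * w.im) ^ 2 = z.im * w.im := sq_sqrt (by positivity)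
  have hE2 : √((z.re - w.re) ^ 2 + (z.im + w.im) ^ 2) ^ 2 =
    (z.re - w.re) ^ 2 + (z.im + w.im) ^ 2 := sq_sqrt (by positivity)
  have hre : (midpt z w).re = (z.re * w.im + w.re * z.im) / (z.im + w.im) := rfl
  have him : (midpt z w).im = √(z.im * w.im) *
    √((z.re - w.re) ^ 2 + (z.im + w.im) ^ 2) / (z.im + w.im) := rfl
  rw [cosh_half_dist, UpperHalfPlane.cosh_dist', UpperHalfPlane.cosh_dist',
    UpperHalfPlane.cosh_dist', hre, him]
  set r := √(z.im * w.im)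
  set e := √((z.re - w.re) ^ 2 + (z.im + w.im) ^ 2)
  have hs : z.im + w.im ≠ 0 := by positivity
  have key : (((z.re * w.im + w.re * z.im) / (z.im + w.im) - v.re) ^ 2 +
      (r * e / (z.im + w.im)) ^ 2 + v.im ^ 2) =
      (w.im * ((z.re - v.re) ^ 2 + z.im ^ 2 + v.im ^ 2) +
        z.im * ((w.re - v.re) ^ 2 + w.im ^ 2 + v.im ^ 2)) / (z.im + w.im) := by
    rw [div_pow (r * e), mul_pow, hr2, hE2]
    field_simp
    ring
  rw [key]
  field_simp
  linear_combination -hr2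

theorem cosh_dist_midpt_midpt (P Q R : UpperHalfPlane) :
    cosh (dist (midpt P Q) (midpt P R)) =
      (1 + cosh (dist P Q) + cosh (dist P R) + cosh (dist Q R)) /
        (4 * cosh (dist P Q / 2) * cosh (dist P R / 2)) := by
  have h1 := cosh_pos (dist P Q / 2)
  have h2 := cosh_pos (dist P R / 2)
  rw [cosh_dist_midpt, dist_comm P (midpt P R), dist_comm Q (midpt P R), cosh_dist_midpt,
    cosh_dist_midpt, dist_self, cosh_zero, dist_comm R P, dist_comm R Q, dist_comm P Q]
  rw [dist_comm P Q] at h1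
  field_simp
  ring

/-! ### Disk coordinates and the law of cosines. -/

/-- The image of `Q` under the isometry to the Poincaré disk carrying `P` to the centre. -/
noncomputable def toDisk (P Q : UpperHalfPlane) : ℂ :=
  ((Q : ℂ) - P) / ((Q : ℂ) - (starRingEnd ℂ) (P : ℂ))

theorem toDisk_re (P Q : UpperHalfPlane) : (toDisk P Q).re =
    ((Q.re - P.re) ^ 2 + Q.im ^ 2 - P.im ^ 2) / ((Q.re - P.re) ^ 2 + (Q.im + P.im) ^ 2) := by
  have hP := P.im_pos
  have hQ := Q.im_pos
  simp only [toDisk, Complex.div_re, Complex.normSq_apply, Complex.sub_re, Complex.sub_im,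
    Complex.conj_re, Complex.conj_im, UpperHalfPlane.coe_re, UpperHalfPlane.coe_im]
  rw [← add_div]
  congr 1 <;> ring

theorem toDisk_im (P Q : UpperHalfPlane) : (toDisk P Q).im =
    (-2 * (Q.re - P.re) * P.im) / ((Q.re - P.re) ^ 2 + (Q.im + P.im) ^ 2) := by
  simp only [toDisk, Complex.div_im, Complex.normSq_apply, Complex.sub_re, Complex.sub_im,
    Complex.conj_re, Complex.conj_im, UpperHalfPlane.coe_re, UpperHalfPlane.coe_im]
  rw [← sub_div]
  congr 1 <;> ring

/-- The norm is tanh(d/2) and the other factor is 2 cosh²(d/2). This converts the Euclidean inner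
product defining the angle into hyperbolic lengths. -/
theorem sinh_dist_eq_norm_toDisk (P Q : UpperHalfPlane) :
    sinh (dist P Q) =
      ‖toDisk P Q‖ * ((Q.re - P.re) ^ 2 + (Q.im + P.im) ^ 2) / (2 * P.im * Q.im) := by
  have hP := P.im_pos
  have hQ := Q.im_pos
  refine (pow_left_inj₀ (sinh_nonneg_iff.2 dist_nonneg) (by positivity) two_ne_zero).1 ?_
  rw [sinh_sq, UpperHalfPlane.cosh_dist', div_pow (‖_‖ * _), mul_pow ‖_‖, Complex.sq_norm, Complex.normSq_apply,
    toDisk_re, toDisk_im]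
  have : (Q.re - P.re) ^ 2 + (Q.im + P.im) ^ 2 ≠ 0 := by positivity
  field_simp
  ring

/-- The hyperbolic law of cosines. -/
theorem cosh_dist_eq_of_angle (P Q R : UpperHalfPlane) :
    cosh (dist Q R) = cosh (dist P Q) * cosh (dist P R) -
      sinh (dist P Q) * sinh (dist P R) * cos (angle P Q R) := by
  have hP := P.im_pos
  have hQ := Q.im_pos
  have hR := R.im_pos
  have hi : cos (angle P Q R) * (‖toDisk P Q‖ * ‖toDisk P R‖) =
      (toDisk P Q).re * (toDisk P R).re + (toDisk P Q).im * (toDisk P R).im := by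
    have := InnerProductGeometry.cos_angle_mul_norm_mul_norm (toDisk P Q) (toDisk P R)
    rw [Complex.inner] at this
    simp only [Complex.mul_re, Complex.conj_re, Complex.conj_im] at this
    unfold angle
    unfold toDisk at *
    linarith
  have h1 : (Q.re - P.re) ^ 2 + (Q.im + P.im) ^ 2 ≠ 0 := by positivity
  have h2 : (R.re - P.re) ^ 2 + (R.im + P.im) ^ 2 ≠ 0 := by positivity
  have h3 : sinh (dist P Q) * sinh (dist P R) * cos (angle P Q R) =
      (cos (angle P Q R) * (‖toDisk P Q‖ * ‖toDisk P R‖)) *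
      (((Q.re - P.re) ^ 2 + (Q.im + P.im) ^ 2) / (2 * P.im * Q.im)) *
      (((R.re - P.re) ^ 2 + (R.im + P.im) ^ 2) / (2 * P.im * R.im)) := by
    rw [sinh_dist_eq_norm_toDisk, sinh_dist_eq_norm_toDisk]
    ring
  rw [h3, hi, toDisk_re, toDisk_re, toDisk_im, toDisk_im, UpperHalfPlane.cosh_dist',
    UpperHalfPlane.cosh_dist', UpperHalfPlane.cosh_dist']
  field_simp
  ring

/-! ### Gram determinant and triangle inequalities. -/

/-- The Gram determinant of a hyperbolic triangle with edge lengths `a`, `b`, `c`. -/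
noncomputable def gram (a b c : ℝ) : ℝ :=
  1 + 2 * cosh a * cosh b * cosh c - cosh a ^ 2 - cosh b ^ 2 - cosh c ^ 2

theorem gram_rotate (a b c : ℝ) : gram b c a = gram a b c := by
  unfold gram; ring

theorem gram_eq_mul (a b c : ℝ) :
    gram a b c = (cosh (b + c) - cosh a) * (cosh a - cosh (b - c)) := by
  rw [cosh_add, cosh_sub]
  unfold gram
  linear_combination (cosh c ^ 2 - 1) * (cosh_sq b) + sinh b ^ 2 * cosh_sq c

/-- The strict triangle inequalities. -/
structure IsTri (a b c : ℝ) : Prop where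
  a_lt : a < b + c
  b_lt : b < c + a
  c_lt : c < a + b

namespace IsTri

variable {a b c : ℝ}

theorem rotate (h : IsTri a b c) : IsTri b c a := ⟨h.b_lt, h.c_lt, h.a_lt⟩

theorem pos (h : IsTri a b c) : 0 < a := by linarith [h.b_lt, h.c_lt]

theorem half (h : IsTri a b c) : IsTri (a / 2) (b / 2) (c / 2) :=
  ⟨by linarith [h.a_lt], by linarith [h.b_lt], by linarith [h.c_lt]⟩

theorem gram_pos (h : IsTri a b c) : 0 < gram a b c := by
  have ha := h.pos
  have hb := h.rotate.pos
  have hc := h.rotate.rotate.pos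
  rw [gram_eq_mul]
  refine mul_pos (sub_pos.2 (cosh_lt_cosh.2 ?_)) (sub_pos.2 (cosh_lt_cosh.2 ?_))
  · rw [abs_of_pos ha, abs_of_pos (by linarith)]
    exact h.a_lt
  · rw [abs_of_pos ha, abs_lt]
    constructor <;> linarith [h.b_lt, h.c_lt]

end IsTri

theorem nondegenerate_iff_isTri (T : Triangle) : T.Nondegenerate ↔ IsTri T.a T.b T.c := by
  have h1 := dist_triangle T.B T.A T.C
  have h2 := dist_triangle T.C T.B T.A
  have h3 := dist_triangle T.A T.C T.B
  simp only [dist_comm T.B T.A, dist_comm T.A T.C, dist_comm T.C T.B] at h1 h2 h3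
  unfold Triangle.Nondegenerate segment Triangle.a Triangle.b Triangle.c
  simp only [Set.mem_ofPred_eq, dist_comm T.B T.A, dist_comm T.A T.C, dist_comm T.C T.B]
  constructor
  · rintro ⟨ha, hb, hc⟩
    constructor
    · exact lt_of_le_of_ne (by linarith) (fun h => ha (by linarith))
    · exact lt_of_le_of_ne (by linarith) (fun h => hb (by linarith))
    · exact lt_of_le_of_ne (by linarith) (fun h => hc (by linarith))
  · rintro ⟨ha, hb, hc⟩
    refine ⟨fun h => ?_, fun h => ?_, fun h => ?_⟩ <;> linarith

/-- The weak triangle inequalities hold for any three points, and equality in one of them kills a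
factor of `gram_eq_mul`. -/
theorem IsTri.of_gram_pos {T : Triangle} (h : 0 < gram T.a T.b T.c) : IsTri T.a T.b T.c := by
  have h1 := dist_triangle T.B T.A T.C
  have h2 := dist_triangle T.C T.B T.A
  have h3 := dist_triangle T.A T.C T.B
  simp only [dist_comm T.B T.A, dist_comm T.A T.C, dist_comm T.C T.B] at h1 h2 h3
  change T.a ≤ T.c + T.b at h1
  change T.b ≤ T.a + T.c at h2
  change T.c ≤ T.b + T.a at h3
  rw [gram_eq_mul] at h
  constructor
  · refine lt_of_le_of_ne (by linarith) fun e => ?_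
    rw [← e] at h
    simp at h
  · refine lt_of_le_of_ne (by linarith) fun e => ?_
    rw [show T.b - T.c = T.a by linarith] at h
    simp at h
  · refine lt_of_le_of_ne (by linarith) fun e => ?_
    rw [← cosh_neg (T.b - T.c), show -(T.b - T.c) = T.a by linarith] at h
    simp at h

/-! ### Sines, the second law of cosines and the angle sum. -/

/-- `θ` is the angle, between edges of lengths `b` and `c`, of a hyperbolic triangle whose third
edge has length `a`. -/
structure IsAngle (θ a b c : ℝ) : Prop where
  nonneg : 0 ≤ θ
  le_pi : θ ≤ π
  cosh_eq : cosh a = cosh b * cosh c - sinh b * sinh c * cos θ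

theorem isAngle_angle (P Q R : UpperHalfPlane) :
    IsAngle (angle P Q R) (dist Q R) (dist R P) (dist P Q) := by
  refine ⟨InnerProductGeometry.angle_nonneg _ _, InnerProductGeometry.angle_le_pi _ _, ?_⟩
  rw [cosh_dist_eq_of_angle P Q R, dist_comm R P]
  ring

theorem isAngle_angleA (T : Triangle) : IsAngle T.angleA T.a T.b T.c := isAngle_angle _ _ _

theorem isAngle_angleB (T : Triangle) : IsAngle T.angleB T.b T.c T.a := isAngle_angle _ _ _

theorem isAngle_angleC (T : Triangle) : IsAngle T.angleC T.c T.a T.b := isAngle_angle _ _ _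

/-- The logarithm of the sine of the angle opposite to the edge of length `a`. -/
noncomputable def logSin (a b c : ℝ) : ℝ := log (gram a b c) / 2 - log (sinh b) - log (sinh c)

namespace IsAngle

variable {θ φ ψ a b c : ℝ}

/-- Squared law of cosines. As `gram` is symmetric, this also contains the law of sines. -/
theorem sin_mul_sq (h : IsAngle θ a b c) : (sin θ * sinh b * sinh c) ^ 2 = gram a b c := by
  have h1 := h.cosh_eq
  have h2 : sinh b * sinh c * cos θ = cosh b * cosh c - cosh a := by linarith
  have h3 : (sin θ * sinh b * sinh c) ^ 2 =
    sinh b ^ 2 * sinh c ^ 2 - (sinh b * sinh c * cos θ) ^ 2 := by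
    linear_combination (sinh b ^ 2 * sinh c ^ 2) * sin_sq_add_cos_sq θ
  rw [h3, h2, sinh_sq, sinh_sq]
  unfold gram
  ring

theorem sin_pos (h : IsAngle θ a b c) (ht : IsTri a b c) : 0 < sin θ := by
  refine lt_of_le_of_ne (sin_nonneg_of_nonneg_of_le_pi h.nonneg h.le_pi) fun e => ?_
  have := h.sin_mul_sq
  rw [← e] at this
  have := ht.gram_pos
  simp at *
  linarith

theorem pos (h : IsAngle θ a b c) (ht : IsTri a b c) : 0 < θ :=
  lt_of_le_of_ne h.nonneg fun e => by simpa [← e] using h.sin_pos ht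

theorem log_sin (h : IsAngle θ a b c) (ht : IsTri a b c) : log (sin θ) = logSin a b c := by
  have h1 := h.sin_pos ht
  have h2 := sinh_pos_iff.2 ht.rotate.pos
  have h3 := sinh_pos_iff.2 ht.rotate.rotate.pos
  rw [logSin, ← h.sin_mul_sq, log_pow, log_mul (by positivity) (by positivity),
    log_mul (by positivity) (by positivity)]
  push_cast
  ring

/-- The second hyperbolic law of cosines. -/
theorem cos_add_cos_mul_cos (h1 : IsAngle θ a b c) (h2 : IsAngle φ b c a) (h3 : IsAngle ψ c a b)
    (ht : IsTri a b c) : cos θ + cos φ * cos ψ = sin φ * sin ψ * cosh a := by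
  have ha := sinh_pos_iff.2 ht.pos
  have hb := sinh_pos_iff.2 ht.rotate.pos
  have hc := sinh_pos_iff.2 ht.rotate.rotate.pos
  have s2 := h2.sin_pos ht.rotate
  have s3 := h3.sin_pos ht.rotate.rotate
  have hg := ht.gram_pos
  have e2 : sin φ * sinh c * sinh a = √(gram a b c) := by
    rw [← gram_rotate, ← h2.sin_mul_sq, sqrt_sq (by positivity)]
  have e3 : sin ψ * sinh a * sinh b = √(gram a b c) := by
    rw [← gram_rotate, ← gram_rotate, ← h3.sin_mul_sq, sqrt_sq (by positivity)]
  have e4 : (sin φ * sinh c * sinh a) * (sin ψ * sinh a * sinh b) = gram a b c := by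
    rw [e2, e3, mul_self_sqrt hg.le]
  have c1 := h1.cosh_eq
  have c2 := h2.cosh_eq
  have c3 := h3.cosh_eq
  have d1 : sinh b * sinh c * cos θ = cosh b * cosh c - cosh a := by linarith
  have d2 : sinh c * sinh a * cos φ = cosh c * cosh a - cosh b := by linarith
  have d3 : sinh a * sinh b * cos ψ = cosh a * cosh b - cosh c := by linarith
  have hne : sinh a ^ 2 * sinh b * sinh c ≠ 0 := by positivity
  refine mul_left_cancel₀ hne ?_
  have l : sinh a ^ 2 * sinh b * sinh c * (cos θ + cos φ * cos ψ) =
      sinh a ^ 2 * (sinh b * sinh c * cos θ) +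
        (sinh c * sinh a * cos φ) * (sinh a * sinh b * cos ψ) := by ring
  have r : sinh a ^ 2 * sinh b * sinh c * (sin φ * sin ψ * cosh a) =
      (sin φ * sinh c * sinh a) * (sin ψ * sinh a * sinh b) * cosh a := by ring
  rw [l, r, e4, d1, d2, d3, sinh_sq]
  unfold gram
  ring

theorem cos_add_cos_add (h1 : IsAngle θ a b c) (h2 : IsAngle φ b c a) (h3 : IsAngle ψ c a b)
    (ht : IsTri a b c) : cos θ + cos (φ + ψ) = sin φ * sin ψ * (cosh a - 1) := by
  rw [cos_add]
  linear_combination h1.cos_add_cos_mul_cos h2 h3 ht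

/-- The second law of cosines gives cos θ > cos(π - (φ + ψ)), and cos decreases on [0, π]; the
absolute value allows for φ + ψ > π. -/
theorem lt_abs_pi_sub (h1 : IsAngle θ a b c) (h2 : IsAngle φ b c a) (h3 : IsAngle ψ c a b)
    (ht : IsTri a b c) : θ < |π - (φ + ψ)| := by
  have hpos : 0 < sin φ * sin ψ * (cosh a - 1) :=
    mul_pos (mul_pos (h2.sin_pos ht.rotate) (h3.sin_pos ht.rotate.rotate))
      (sub_pos.2 (one_lt_cosh.2 ht.pos.ne'))
  rw [← h1.cos_add_cos_add h2 h3 ht] at hpos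
  by_contra! hle
  have := cos_le_cos_of_nonneg_of_le_pi (abs_nonneg _) h1.le_pi hle
  rw [cos_abs, cos_pi_sub] at this
  linarith

theorem sum_lt_pi (h1 : IsAngle θ a b c) (h2 : IsAngle φ b c a) (h3 : IsAngle ψ c a b)
    (ht : IsTri a b c) : θ + φ + ψ < π := by
  have l1 := h1.lt_abs_pi_sub h2 h3 ht
  have l2 := h2.lt_abs_pi_sub h3 h1 ht.rotate
  -- Otherwise θ < φ + ψ - π and φ < ψ + θ - π, whose sum gives ψ > π.
  by_contra! hge
  rcases lt_abs.1 l1 with l | l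
  · linarith
  rcases lt_abs.1 l2 with l' | l'
  · linarith
  linarith [h3.le_pi]

end IsAngle

theorem angles_mem_hyperbolicAngles {T : Triangle} (ht : IsTri T.a T.b T.c) :
    T.angles ∈ hyperbolicAngles :=
  ⟨(isAngle_angleA T).pos ht, (isAngle_angleB T).pos ht.rotate,
    (isAngle_angleC T).pos ht.rotate.rotate,
    (isAngle_angleA T).sum_lt_pi (isAngle_angleB T) (isAngle_angleC T) ht⟩

/-! ### Midsegments and the effect of one subdivision. -/

/-- `m` is the length of the midsegment facing the edge of length `a` in a hyperbolic triangle
with edge lengths `a`, `b`, `c`. -/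
structure IsMidsegment (m a b c : ℝ) : Prop where
  nonneg : 0 ≤ m
  cosh_eq : cosh m = (cosh (a / 2) ^ 2 + cosh (b / 2) ^ 2 + cosh (c / 2) ^ 2 - 1) /
    (2 * cosh (b / 2) * cosh (c / 2))

theorem cosh_eq_cosh_half (a : ℝ) : cosh a = 2 * cosh (a / 2) ^ 2 - 1 := by
  have h := cosh_two_mul (a / 2)
  rw [mul_div_cancel₀ a two_ne_zero, sinh_sq] at h
  linarith

theorem log_sinh_eq {a : ℝ} (ha : 0 < a) :
    log (sinh a) = log 2 + log (sinh (a / 2)) + log (cosh (a / 2)) := by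
  have h1 : 0 < sinh (a / 2) := sinh_pos_iff.2 (by linarith)
  have h2 := cosh_pos (a / 2)
  rw [← log_mul (by norm_num) h1.ne', ← log_mul (by positivity) h2.ne', ← sinh_two_mul,
    mul_div_cancel₀ a two_ne_zero]

theorem log_cosh_nonneg (a : ℝ) : 0 ≤ log (cosh a) := log_nonneg (one_le_cosh a)

theorem log_cosh_le (a : ℝ) : log (cosh a) ≤ sinh a ^ 2 / 2 := by
  have h := log_le_sub_one_of_pos (x := cosh a ^ 2) (by have := cosh_pos a; positivity)
  rw [log_pow] at h
  rw [sinh_sq]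
  push_cast at h
  linarith

theorem sinh_sq_half_le (a : ℝ) : sinh (a / 2) ^ 2 ≤ sinh a ^ 2 / 4 := by
  have h1 := one_le_cosh (a / 2)
  rw [sinh_sq a, cosh_eq_cosh_half a, sinh_sq]
  nlinarith [sq_nonneg (cosh (a / 2) ^ 2 - 1)]

/-- The bracket in the second term is the numerator of cosh m in `IsMidsegment`, whence the exact
scaling in `gram_corner` and `gram_medial`. -/
theorem gram_eq_half (a b c : ℝ) : gram a b c =
    16 * (cosh (a / 2) * cosh (b / 2) * cosh (c / 2)) ^ 2 -
      4 * (cosh (a / 2) ^ 2 + cosh (b / 2) ^ 2 + cosh (c / 2) ^ 2 - 1) ^ 2 := by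
  rw [gram, cosh_eq_cosh_half a, cosh_eq_cosh_half b, cosh_eq_cosh_half c]
  ring

namespace IsMidsegment

variable {m a b c : ℝ}

theorem pos (h : IsMidsegment m a b c) (ht : IsTri a b c) : 0 < m := by
  refine lt_of_le_of_ne h.nonneg fun e => ?_
  have h1 := h.cosh_eq
  have hY := cosh_pos (b / 2)
  have hZ := cosh_pos (c / 2)
  have hX : 1 < cosh (a / 2) := one_lt_cosh.2 (by linarith [ht.pos])
  rw [← e, cosh_zero, eq_div_iff (by positivity)] at h1
  nlinarith [sq_nonneg (cosh (b / 2) - cosh (c / 2))]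

/-- Equivalent to nonnegativity of the Gram determinant of the half edges, which satisfy the
triangle inequalities too. -/
theorem cosh_le (h : IsMidsegment m a b c) (ht : IsTri a b c) : cosh m ≤ cosh (a / 2) := by
  have hg := ht.half.gram_pos
  have hY := cosh_pos (b / 2)
  have hZ := cosh_pos (c / 2)
  rw [h.cosh_eq, div_le_iff₀ (by positivity)]
  unfold gram at hg
  linarith

theorem le_half (h : IsMidsegment m a b c) (ht : IsTri a b c) : m ≤ a / 2 := by
  have := cosh_le_cosh.1 (h.cosh_le ht)
  rwa [abs_of_nonneg h.nonneg, abs_of_nonneg (by linarith [ht.pos])] at this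

theorem sinh_half_sq_le (h : IsMidsegment m a b c) (ht : IsTri a b c) :
    sinh (m / 2) ^ 2 ≤ sinh (a / 2) ^ 2 / 4 := by
  refine le_trans ?_ (sinh_sq_half_le (a / 2))
  have h0 := h.pos ht
  have h1 := h.le_half ht
  exact pow_le_pow_left₀ (sinh_nonneg_iff.2 (by linarith)) (sinh_le_sinh.2 (by linarith)) 2

theorem log_sinh_le (h : IsMidsegment m a b c) (ht : IsTri a b c) :
    log (sinh m) ≤ log (sinh (a / 2)) :=
  log_le_log (sinh_pos_iff.2 (h.pos ht)) (sinh_le_sinh.2 (h.le_half ht))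

theorem sinh_sq_le (h : IsMidsegment m a b c) :
    sinh (a / 2) ^ 2 ≤ cosh (b / 2) * cosh (c / 2) * sinh m ^ 2 := by
  have hY := cosh_pos (b / 2)
  have hZ := cosh_pos (c / 2)
  -- Difference of squares in cosh² m - 1. The bound follows by dropping the square of the
  -- difference and using (y + z)² ≥ 4yz.
  have e : cosh (b / 2) * cosh (c / 2) * sinh m ^ 2 =
      ((sinh (a / 2) ^ 2 + (cosh (b / 2) - cosh (c / 2)) ^ 2) *
        (sinh (a / 2) ^ 2 + (cosh (b / 2) + cosh (c / 2)) ^ 2)) /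
        (4 * cosh (b / 2) * cosh (c / 2)) := by
    rw [sinh_sq m, sinh_sq (a / 2), h.cosh_eq]
    field_simp
    ring
  rw [e, le_div_iff₀ (by positivity)]
  have hp := sq_nonneg (sinh (a / 2))
  have hd := sq_nonneg (cosh (b / 2) - cosh (c / 2))
  calc sinh (a / 2) ^ 2 * (4 * cosh (b / 2) * cosh (c / 2))
      ≤ sinh (a / 2) ^ 2 * (sinh (a / 2) ^ 2 + (cosh (b / 2) + cosh (c / 2)) ^ 2) := by
        gcongr
        nlinarith
    _ ≤ _ := by
        gcongr
        linarith

theorem log_sinh_half_le (h : IsMidsegment m a b c) (ht : IsTri a b c) :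
    log (sinh (a / 2)) ≤
      log (sinh m) + log (cosh (b / 2)) / 2 + log (cosh (c / 2)) / 2 := by
  have hY := cosh_pos (b / 2)
  have hZ := cosh_pos (c / 2)
  have hm := sinh_pos_iff.2 (h.pos ht)
  have ha : 0 < sinh (a / 2) := sinh_pos_iff.2 (by linarith [ht.pos])
  have := log_le_log (by positivity) h.sinh_sq_le
  rw [log_mul (by positivity) (by positivity), log_mul hY.ne' hZ.ne', log_pow, log_pow] at this
  push_cast at this
  linarith

theorem gram_corner (h : IsMidsegment m a b c) :
    gram m (b / 2) (c / 2) = gram a b c / (4 * cosh (b / 2) * cosh (c / 2)) ^ 2 := by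
  have hY := cosh_pos (b / 2)
  have hZ := cosh_pos (c / 2)
  rw [gram_eq_half a b c, gram, h.cosh_eq]
  field_simp
  ring

theorem gram_medial {n k : ℝ} (ha : IsMidsegment m a b c) (hb : IsMidsegment n b c a)
    (hc : IsMidsegment k c a b) : gram m n k =
      gram a b c / (4 * cosh (a / 2) * cosh (b / 2) * cosh (c / 2)) ^ 2 := by
  have hX := cosh_pos (a / 2)
  have hY := cosh_pos (b / 2)
  have hZ := cosh_pos (c / 2)
  rw [gram_eq_half a b c, gram, ha.cosh_eq, hb.cosh_eq, hc.cosh_eq]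
  field_simp
  ring

/-- A corner triangle keeps the angle at its own vertex. -/
theorem logSin_corner_self (h : IsMidsegment m a b c) (ht : IsTri a b c) :
    logSin m (b / 2) (c / 2) = logSin a b c := by
  have hY := cosh_pos (b / 2)
  have hZ := cosh_pos (c / 2)
  have hg := ht.gram_pos
  rw [logSin, logSin, h.gram_corner, log_sinh_eq ht.rotate.pos, log_sinh_eq ht.rotate.rotate.pos,
    log_div hg.ne' (by positivity), log_pow, log_mul (by positivity) (by positivity),
    log_mul (by positivity) (by positivity), show (4 : ℝ) = 2 ^ 2 by norm_num, log_pow]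
  push_cast
  ring

theorem logSin_corner_right (h : IsMidsegment m a b c) (ht : IsTri a b c) :
    logSin (b / 2) (c / 2) m = logSin b c a + log (sinh (a / 2)) - log (sinh m) +
      log (cosh (a / 2)) - log (cosh (b / 2)) := by
  have h1 := h.logSin_corner_self ht
  rw [logSin, logSin] at h1
  rw [logSin, logSin, gram_rotate m, gram_rotate a]
  linarith [log_sinh_eq ht.pos, log_sinh_eq ht.rotate.pos]

theorem logSin_corner_left (h : IsMidsegment m a b c) (ht : IsTri a b c) :
    logSin (c / 2) m (b / 2) = logSin c a b + log (sinh (a / 2)) - log (sinh m) +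
      log (cosh (a / 2)) - log (cosh (c / 2)) := by
  have h1 := h.logSin_corner_self ht
  rw [logSin, logSin] at h1
  rw [logSin, logSin, gram_rotate (b / 2), gram_rotate m, gram_rotate b, gram_rotate a]
  linarith [log_sinh_eq ht.pos, log_sinh_eq ht.rotate.rotate.pos]

theorem logSin_medial {n k : ℝ} (ha : IsMidsegment m a b c) (hb : IsMidsegment n b c a)
    (hc : IsMidsegment k c a b) (ht : IsTri a b c) :
    logSin m n k = logSin a b c + log (sinh (b / 2)) - log (sinh n) + log (sinh (c / 2)) -
      log (sinh k) - log (cosh (a / 2)) := by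
  have hX := cosh_pos (a / 2)
  have hY := cosh_pos (b / 2)
  have hZ := cosh_pos (c / 2)
  have hg := ht.gram_pos
  rw [logSin, logSin, ha.gram_medial hb hc, log_sinh_eq ht.rotate.pos,
    log_sinh_eq ht.rotate.rotate.pos,
    log_div hg.ne' (by positivity), log_pow, log_mul (by positivity) (by positivity),
    log_mul (by positivity) (by positivity), log_mul (by positivity) (by positivity),
    show (4 : ℝ) = 2 ^ 2 by norm_num, log_pow]
  push_cast
  ring

end IsMidsegment

/-! ### Contraction estimates for one step. -/

/-- `sinh² (a/2) + sinh² (b/2) + sinh² (c/2)`. -/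
noncomputable def size (a b c : ℝ) : ℝ := sinh (a / 2) ^ 2 + sinh (b / 2) ^ 2 + sinh (c / 2) ^ 2

theorem size_rotate (a b c : ℝ) : size b c a = size a b c := by unfold size; ring

/-- The estimates relating a triangle with edge lengths `a`, `b`, `c` to the next one, with edge
lengths `a'`, `b'`, `c'`. -/
structure Contracts (a b c a' b' c' : ℝ) : Prop where
  gram_pos : 0 < gram a' b' c'
  size_le : size a' b' c' ≤ size a b c / 4
  logSin_a : |logSin a' b' c' - logSin a b c| ≤ size a b c / 2
  logSin_b : |logSin b' c' a' - logSin b c a| ≤ size a b c / 2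
  logSin_c : |logSin c' a' b' - logSin c a b| ≤ size a b c / 2

theorem Contracts.rotate {a b c a' b' c' : ℝ} (h : Contracts a b c a' b' c') :
    Contracts b c a b' c' a' := by
  refine ⟨?_, ?_, ?_, ?_, ?_⟩
  · rw [gram_rotate]; exact h.gram_pos
  · rw [size_rotate a', size_rotate a]; exact h.size_le
  · rw [size_rotate]; exact h.logSin_b
  · rw [size_rotate]; exact h.logSin_c
  · rw [size_rotate]; exact h.logSin_a

theorem Contracts.corner {m a b c : ℝ} (h : IsMidsegment m a b c) (ht : IsTri a b c) :
    Contracts a b c m (b / 2) (c / 2) := by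
  have hY := cosh_pos (b / 2)
  have hZ := cosh_pos (c / 2)
  have hg := ht.gram_pos
  have u := h.log_sinh_half_le ht
  have l := h.log_sinh_le ht
  have pX := log_cosh_nonneg (a / 2)
  have pY := log_cosh_nonneg (b / 2)
  have pZ := log_cosh_nonneg (c / 2)
  have qX := log_cosh_le (a / 2)
  have qY := log_cosh_le (b / 2)
  have qZ := log_cosh_le (c / 2)
  refine ⟨?_, ?_, ?_, ?_, ?_⟩
  · rw [h.gram_corner]; positivity
  · unfold size
    linarith [h.sinh_half_sq_le ht, sinh_sq_half_le (b / 2), sinh_sq_half_le (c / 2)]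
  · rw [h.logSin_corner_self ht, sub_self, abs_zero]
    unfold size
    positivity
  · rw [h.logSin_corner_right ht, abs_le]
    unfold size
    constructor <;> linarith
  · rw [h.logSin_corner_left ht, abs_le]
    unfold size
    constructor <;> linarith

/-- The two sinh quotients contribute ln cosh(a/2) / 2 each to the upper bound, which the last term
of `logSin_medial` cancels; what remains is bounded by `log_cosh_le`. -/
theorem abs_logSin_medial_sub_le {m n k a b c : ℝ} (ha : IsMidsegment m a b c)
    (hb : IsMidsegment n b c a) (hc : IsMidsegment k c a b) (ht : IsTri a b c) :
    |logSin m n k - logSin a b c| ≤ size a b c / 2 := by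
  have u := hb.log_sinh_half_le ht.rotate
  have l := hb.log_sinh_le ht.rotate
  have u' := hc.log_sinh_half_le ht.rotate.rotate
  have l' := hc.log_sinh_le ht.rotate.rotate
  have pX := log_cosh_nonneg (a / 2)
  have pY := log_cosh_nonneg (b / 2)
  have pZ := log_cosh_nonneg (c / 2)
  have qX := log_cosh_le (a / 2)
  have qY := log_cosh_le (b / 2)
  have qZ := log_cosh_le (c / 2)
  rw [ha.logSin_medial hb hc ht, abs_le]
  unfold size
  constructor <;> linarith

theorem Contracts.medial {m n k a b c : ℝ} (ha : IsMidsegment m a b c)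
    (hb : IsMidsegment n b c a) (hc : IsMidsegment k c a b) (ht : IsTri a b c) :
    Contracts a b c m n k := by
  have hX := cosh_pos (a / 2)
  have hY := cosh_pos (b / 2)
  have hZ := cosh_pos (c / 2)
  have hg := ht.gram_pos
  refine ⟨?_, ?_, abs_logSin_medial_sub_le ha hb hc ht, ?_, ?_⟩
  · rw [ha.gram_medial hb hc]; positivity
  · unfold size
    linarith [ha.sinh_half_sq_le ht, hb.sinh_half_sq_le ht.rotate,
      hc.sinh_half_sq_le ht.rotate.rotate]
  · rw [← size_rotate]; exact abs_logSin_medial_sub_le hb hc ha ht.rotate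
  · rw [← size_rotate, ← size_rotate]; exact abs_logSin_medial_sub_le hc ha hb ht.rotate.rotate

theorem isMidsegment_dist (P Q R : UpperHalfPlane) :
    IsMidsegment (dist (midpt P Q) (midpt P R)) (dist Q R) (dist R P) (dist P Q) := by
  refine ⟨dist_nonneg, ?_⟩
  rw [cosh_dist_midpt_midpt, cosh_eq_cosh_half (dist P Q), cosh_eq_cosh_half (dist P R),
    cosh_eq_cosh_half (dist Q R), dist_comm R P]
  have h1 := cosh_pos (dist P Q / 2)
  have h2 := cosh_pos (dist P R / 2)
  field_simp
  ring

theorem contracts_step (l : Letter) (T : Triangle) (ht : IsTri T.a T.b T.c) :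
    Contracts T.a T.b T.c (step l T).a (step l T).b (step l T).c := by
  have ha : IsMidsegment _ T.a T.b T.c := isMidsegment_dist T.A T.B T.C
  have hb : IsMidsegment _ T.b T.c T.a := isMidsegment_dist T.B T.C T.A
  have hc : IsMidsegment _ T.c T.a T.b := isMidsegment_dist T.C T.A T.B
  cases l
  · have := Contracts.corner ha ht
    have e2 : T.fA.b = T.b / 2 := by
      show dist (midpt T.A T.C) T.A = dist T.C T.A / 2
      rw [midpt_comm, dist_midpt_right]
    have e3 : T.fA.c = T.c / 2 := dist_midpt_left _ _
    show Contracts _ _ _ T.fA.a T.fA.b T.fA.c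
    rw [e2, e3]
    exact this
  -- The corner at B is the corner at A after one cyclic relabelling; two more restore the order.
  · have := (Contracts.corner hb ht.rotate).rotate.rotate
    have e1 : T.fB.b = dist (midpt T.B T.C) (midpt T.B T.A) := by
      show dist (midpt T.B T.C) (midpt T.A T.B) = _
      rw [midpt_comm T.A]
    have e2 : T.fB.c = T.c / 2 := dist_midpt_right _ _
    have e3 : T.fB.a = T.a / 2 := dist_midpt_left _ _
    show Contracts _ _ _ T.fB.a T.fB.b T.fB.c
    rw [e1, e2, e3]
    exact this
  · have := (Contracts.corner hc ht.rotate.rotate).rotate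
    have e1 : T.fC.c = dist (midpt T.C T.A) (midpt T.C T.B) := by
      show dist (midpt T.A T.C) (midpt T.B T.C) = _
      rw [midpt_comm T.A, midpt_comm T.B]
    have e2 : T.fC.a = T.a / 2 := dist_midpt_right _ _
    have e3 : T.fC.b = T.b / 2 := by
      show dist T.C (midpt T.A T.C) = dist T.C T.A / 2
      rw [midpt_comm, dist_midpt_left]
    show Contracts _ _ _ T.fC.a T.fC.b T.fC.c
    rw [e1, e2, e3]
    exact this
  · have := Contracts.medial ha hb hc ht
    have e1 : T.fM.a = dist (midpt T.A T.B) (midpt T.A T.C) := by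
      show dist (midpt T.C T.A) (midpt T.A T.B) = _
      rw [midpt_comm T.C, dist_comm]
    have e2 : T.fM.b = dist (midpt T.B T.C) (midpt T.B T.A) := by
      show dist (midpt T.A T.B) (midpt T.B T.C) = _
      rw [midpt_comm T.A, dist_comm]
    have e3 : T.fM.c = dist (midpt T.C T.A) (midpt T.C T.B) := by
      show dist (midpt T.B T.C) (midpt T.C T.A) = _
      rw [midpt_comm T.B, dist_comm]
    show Contracts _ _ _ T.fM.a T.fM.b T.fM.c
    rw [e1, e2, e3]
    exact this

/-! ### Geometric decay along the orbit. -/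

theorem isTri_iter {T₀ : Triangle} (h : IsTri T₀.a T₀.b T₀.c) (s : ℕ → Letter) (n : ℕ) :
    IsTri (iter s T₀ n).a (iter s T₀ n).b (iter s T₀ n).c := by
  induction n with
  | zero => exact h
  | succ n ih => exact IsTri.of_gram_pos (contracts_step (s n) _ ih).gram_pos

theorem sizeConst_pos {T : Triangle} (h : IsTri T.a T.b T.c) : 0 < sizeConst T := by
  have : 0 < sinh (T.a / 2) := sinh_pos_iff.2 (by linarith [h.pos])
  unfold sizeConst
  positivity

theorem le_geometric {K : ℕ → ℝ} (hK : ∀ n, K (n + 1) ≤ K n / 4) (n : ℕ) :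
    K n ≤ (1 / 4) ^ n * K 0 := by
  induction n with
  | zero => simp
  | succ n ih => rw [pow_succ]; linarith [hK n]

theorem tendsto_zero_of_quarter {K : ℕ → ℝ} (hpos : ∀ n, 0 < K n)
    (hK : ∀ n, K (n + 1) ≤ K n / 4) : Tendsto K atTop (𝓝 0) := by
  refine squeeze_zero (fun n => (hpos n).le) (le_geometric hK) ?_
  simpa using (tendsto_pow_atTop_nhds_zero_of_lt_one (r := (1 / 4 : ℝ)) (by norm_num)
    (by norm_num)).mul_const (K 0)

theorem abs_sub_lt_of_quarter {K u : ℕ → ℝ} (hpos : ∀ n, 0 < K n)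
    (hK : ∀ n, K (n + 1) ≤ K n / 4) (hu : ∀ n, |u (n + 1) - u n| ≤ K n / 2) (n k : ℕ) :
    |u (n + k) - u n| < K n := by
  -- From K (j+1) ≤ K j / 4 one has K j / 2 ≤ 2/3 (K j - K (j+1)), so the increments telescope; 2/3
  -- < 1 leaves room for strictness.
  have h : |u (n + k) - u n| ≤ 2 / 3 * (K n - K (n + k)) := by
    induction k with
    | zero => simp
    | succ k ih =>
      have h1 := abs_sub_le (u (n + (k + 1))) (u (n + k)) (u n)
      have h2 := hu (n + k)
      have h3 := hK (n + k)
      rw [← add_assoc] at *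
      linarith
  linarith [hpos n, hpos (n + k)]

theorem logSinCauchy_of_quarter {θ : Triangle → ℝ} {T : ℕ → Triangle} {K : ℕ → ℝ}
    (hpos : ∀ n, 0 < K n) (hK : ∀ n, K (n + 1) ≤ K n / 4)
    (hu : ∀ n, |log (sin (θ (T (n + 1)))) - log (sin (θ (T n)))| ≤ K n / 2) :
    LogSinCauchy θ T (K 0) := by
  have h := abs_sub_lt_of_quarter (u := fun n => log (sin (θ (T n)))) hpos hK hu
  constructor
  · refine cauchySeq_of_le_tendsto_0' K (fun n m hnm => ?_) (tendsto_zero_of_quarter hpos hK)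
    obtain ⟨k, rfl⟩ := Nat.exists_eq_add_of_le hnm
    rw [dist_comm]
    exact (h n k).le
  · intro n k
    refine (h n k).trans_le ((le_geometric hK n).trans ?_)
    -- The decay obtained is 4⁻ⁿ; only 2⁻ⁿ is required.
    rw [one_div_pow]
    gcongr
    · exact (hpos 0).le
    · norm_num

/-! ### Convergence of the angles. -/

/-- If the logarithms of the sines converge and the angular defect, measured by
`cos A + cos (B + C)`, tends to `0`, then the angle converges to an angle in `(0, π)`. -/
theorem exists_tendsto_angle {A B C : ℕ → ℝ} (hA : ∀ n, 0 < A n ∧ A n < π)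
    (hB : ∀ n, 0 < B n ∧ B n < π) (hC : ∀ n, 0 < C n ∧ C n < π)
    (cA : CauchySeq fun n => log (sin (A n))) (cB : CauchySeq fun n => log (sin (B n)))
    (cC : CauchySeq fun n => log (sin (C n)))
    (hd : Tendsto (fun n => cos (A n) + cos (B n + C n)) atTop (𝓝 0)) :
    ∃ α, 0 < α ∧ α ≤ π ∧ Tendsto A atTop (𝓝 α) := by
  have key : ∀ X : ℕ → ℝ, (∀ n, 0 < X n ∧ X n < π) → CauchySeq (fun n => log (sin (X n))) →
      ∃ σ, 0 < σ ∧ Tendsto (fun n => sin (X n)) atTop (𝓝 σ) := by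
    intro X hX c
    obtain ⟨l, hl⟩ := cauchySeq_tendsto_of_complete c
    refine ⟨exp l, exp_pos l, ((continuous_exp.tendsto l).comp hl).congr fun n => ?_⟩
    exact exp_log (sin_pos_of_pos_of_lt_pi (hX n).1 (hX n).2)
  obtain ⟨σA, pA, tA⟩ := key A hA cA
  obtain ⟨σB, pB, tB⟩ := key B hB cB
  obtain ⟨σC, pC, tC⟩ := key C hC cC
  set e : ℕ → ℝ := fun n => cos (A n) + cos (B n + C n) with he
  -- For e = 0 this is the Euclidean law of cosines with the sines as side lengths. It fixes cos A,
  -- hence decides between an angle and its supplement.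
  have hcos : ∀ n, cos (A n) = (sin (B n) ^ 2 + sin (C n) ^ 2 - sin (A n) ^ 2 -
      2 * e n * cos (A n) + e n ^ 2 + 2 * sin (B n) * sin (C n) * e n) /
      (2 * sin (B n) * sin (C n)) := by
    intro n
    have sB := sin_pos_of_pos_of_lt_pi (hB n).1 (hB n).2
    have sC := sin_pos_of_pos_of_lt_pi (hC n).1 (hC n).2
    rw [eq_div_iff (by positivity)]
    simp only [he]
    rw [cos_add]
    have a1 := sin_sq_add_cos_sq (A n)
    have b1 := sin_sq_add_cos_sq (B n)
    have c1 := sin_sq_add_cos_sq (C n)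
    linear_combination a1 - (cos (C n)) ^ 2 * b1 + (sin (B n) ^ 2 - 1) * c1
  -- The right side of `hcos` still contains cos A, but only multiplied by e, so boundedness
  -- suffices.
  have hb : Tendsto (fun n => e n * cos (A n)) atTop (𝓝 0) :=
    hd.zero_mul_isBoundedUnder_le
      (isBoundedUnder_of ⟨1, fun n => by simpa using abs_cos_le_one (A n)⟩)
  have hlim : Tendsto (fun n => cos (A n)) atTop (𝓝 ((σB ^ 2 + σC ^ 2 - σA ^ 2 - 2 * 0 + 0 ^ 2 +
      2 * σB * σC * 0) / (2 * σB * σC))) := by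
    have := (((((((tB.pow 2).add (tC.pow 2)).sub (tA.pow 2)).sub (hb.const_mul 2)).add
      (hd.pow 2)).add (((tB.const_mul 2).mul tC).mul hd))).div ((tB.const_mul 2).mul tC)
      (by positivity)
    refine this.congr fun n => ?_
    simp only [Pi.div_apply]
    rw [← mul_assoc]
    exact (hcos n).symm
  have hconv := (continuous_arccos.tendsto _).comp hlim
  have hconv' := hconv.congr fun n => arccos_cos (hA n).1.le (hA n).2.le
  refine ⟨_, ?_, arccos_le_pi _, hconv'⟩
  refine lt_of_le_of_ne (arccos_nonneg _) fun h0 => ?_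
  rw [← h0] at hconv'
  have := tendsto_nhds_unique ((continuous_sin.tendsto 0).comp hconv') tA
  simp at this
  linarith

theorem sinh_sq_half_le_sizeConst (T : Triangle) : sinh (T.a / 2) ^ 2 ≤ sizeConst T ∧
    sinh (T.b / 2) ^ 2 ≤ sizeConst T ∧ sinh (T.c / 2) ^ 2 ≤ sizeConst T := by
  have h1 := sq_nonneg (sinh (T.a / 2))
  have h2 := sq_nonneg (sinh (T.b / 2))
  have h3 := sq_nonneg (sinh (T.c / 2))
  unfold sizeConst
  refine ⟨?_, ?_, ?_⟩ <;> linarith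

theorem IsAngle.cos_add_cos_add_mem {θ φ ψ a b c : ℝ} (h1 : IsAngle θ a b c)
    (h2 : IsAngle φ b c a) (h3 : IsAngle ψ c a b) (ht : IsTri a b c) :
    0 ≤ cos θ + cos (φ + ψ) ∧ cos θ + cos (φ + ψ) ≤ 2 * sinh (a / 2) ^ 2 := by
  have s2 := h2.sin_pos ht.rotate
  have s3 := h3.sin_pos ht.rotate.rotate
  have e : cosh a - 1 = 2 * sinh (a / 2) ^ 2 := by
    rw [cosh_eq_cosh_half, sinh_sq]; ring
  rw [h1.cos_add_cos_add h2 h3 ht, e]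
  refine ⟨by positivity, mul_le_of_le_one_left (by positivity) ?_⟩
  exact mul_le_one₀ (sin_le_one _) s3.le (sin_le_one _)

end HypIFS

open HypIFS Real in
theorem mainTheorem2 (T₀ : HypIFS.Triangle) (hT₀ : T₀.Nondegenerate)
    (s : ℕ → HypIFS.Letter) :
    (∀ n : ℕ, (HypIFS.iter s T₀ n).Nondegenerate ∧
      (HypIFS.iter s T₀ n).angles ∈ HypIFS.hyperbolicAngles) ∧
    (∃ p ∈ HypIFS.euclideanAngles,
      Tendsto (fun n : ℕ => (HypIFS.iter s T₀ n).angles) atTop (𝓝 p)) ∧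
    HypIFS.LogSinCauchy HypIFS.Triangle.angleA (HypIFS.iter s T₀) (HypIFS.sizeConst T₀) ∧
    HypIFS.LogSinCauchy HypIFS.Triangle.angleB (HypIFS.iter s T₀) (HypIFS.sizeConst T₀) ∧
    HypIFS.LogSinCauchy HypIFS.Triangle.angleC (HypIFS.iter s T₀) (HypIFS.sizeConst T₀) := by
  have ht := isTri_iter ((nondegenerate_iff_isTri T₀).1 hT₀) s
  have hct := fun n => contracts_step (s n) _ (ht n)
  have hpos := fun n => sizeConst_pos (ht n)
  have hK : ∀ n, sizeConst (iter s T₀ (n + 1)) ≤ sizeConst (iter s T₀ n) / 4 :=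
    fun n => (hct n).size_le
  have hmem := fun n => angles_mem_hyperbolicAngles (ht n)
  have iA := fun n => isAngle_angleA (iter s T₀ n)
  have iB := fun n => isAngle_angleB (iter s T₀ n)
  have iC := fun n => isAngle_angleC (iter s T₀ n)
  have LA : LogSinCauchy Triangle.angleA (iter s T₀) (sizeConst T₀) := by
    refine logSinCauchy_of_quarter hpos hK fun n => ?_
    rw [(iA _).log_sin (ht _), (iA _).log_sin (ht _)]
    exact (hct n).logSin_a
  have LB : LogSinCauchy Triangle.angleB (iter s T₀) (sizeConst T₀) := by
    refine logSinCauchy_of_quarter hpos hK fun n => ?_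
    rw [(iB _).log_sin (ht _).rotate, (iB _).log_sin (ht _).rotate]
    exact (hct n).logSin_b
  have LC : LogSinCauchy Triangle.angleC (iter s T₀) (sizeConst T₀) := by
    refine logSinCauchy_of_quarter hpos hK fun n => ?_
    rw [(iC _).log_sin (ht _).rotate.rotate, (iC _).log_sin (ht _).rotate.rotate]
    exact (hct n).logSin_c
  refine ⟨fun n => ⟨(nondegenerate_iff_isTri _).2 (ht n), hmem n⟩, ?_, LA, LB, LC⟩
  have hK0 : Tendsto (fun n => 2 * sizeConst (iter s T₀ n)) atTop (𝓝 0) := by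
    simpa using (tendsto_zero_of_quarter hpos hK).const_mul 2
  have hlt : ∀ n, (0 < (iter s T₀ n).angleA ∧ (iter s T₀ n).angleA < π) ∧
      (0 < (iter s T₀ n).angleB ∧ (iter s T₀ n).angleB < π) ∧
      (0 < (iter s T₀ n).angleC ∧ (iter s T₀ n).angleC < π) := by
    intro n
    obtain ⟨h1, h2, h3, h4⟩ := hmem n
    simp only [Triangle.angles] at h1 h2 h3 h4
    refine ⟨⟨h1, ?_⟩, ⟨h2, ?_⟩, ⟨h3, ?_⟩⟩ <;> linarith
  have bound := fun n => sinh_sq_half_le_sizeConst (iter s T₀ n)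
  have dA := fun n => (iA n).cos_add_cos_add_mem (iB n) (iC n) (ht n)
  have dB := fun n => (iB n).cos_add_cos_add_mem (iC n) (iA n) (ht n).rotate
  have dC := fun n => (iC n).cos_add_cos_add_mem (iA n) (iB n) (ht n).rotate.rotate
  have tA := squeeze_zero (fun n => (dA n).1) (fun n => by linarith [(dA n).2, (bound n).1]) hK0
  have tB := squeeze_zero (fun n => (dB n).1) (fun n => by linarith [(dB n).2, (bound n).2.1]) hK0
  have tC := squeeze_zero (fun n => (dC n).1) (fun n => by linarith [(dC n).2, (bound n).2.2]) hK0
  obtain ⟨α, α0, απ, hα⟩ := exists_tendsto_angle (fun n => (hlt n).1) (fun n => (hlt n).2.1)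
    (fun n => (hlt n).2.2) LA.1 LB.1 LC.1 tA
  obtain ⟨β, β0, -, hβ⟩ := exists_tendsto_angle (fun n => (hlt n).2.1) (fun n => (hlt n).2.2)
    (fun n => (hlt n).1) LB.1 LC.1 LA.1 tB
  obtain ⟨γ, γ0, -, hγ⟩ := exists_tendsto_angle (fun n => (hlt n).2.2) (fun n => (hlt n).1)
    (fun n => (hlt n).2.1) LC.1 LA.1 LB.1 tC
  refine ⟨(α, β, γ), ⟨α0, β0, γ0, ?_⟩, hα.prodMk_nhds (hβ.prodMk_nhds hγ)⟩
  -- Places π - (β + γ) in [0, π], where cos is injective.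
  have hle : α + β + γ ≤ π :=
    le_of_tendsto ((hα.add hβ).add hγ) (Eventually.of_forall fun n => (hmem n).2.2.2.le)
  have hcos : cos α + cos (β + γ) = 0 :=
    tendsto_nhds_unique (((Real.continuous_cos.tendsto α).comp hα).add
      ((Real.continuous_cos.tendsto (β + γ)).comp (hβ.add hγ))) tA
  have heq : cos α = cos (π - (β + γ)) := by rw [Real.cos_pi_sub]; linarith
  have := Real.injOn_cos ⟨α0.le, απ⟩ ⟨by linarith, by linarith⟩ heq
  show α + β + γ = π
  linarith
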